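/- **Setting.** Quantum systems are represented by complex Hilbert spaces $\mathcal H$ of arbitrary (finite or infinite) dimension; they include the trivial system $\mathbb C$ and are closed under tensor products. A quantum resource theory assigns to each system a set $\mathcal S(\mathcal H)$ of density operators, compact in the trace norm topology, with $\phi\otimes\psi\in\mathcal S(\mathcal H\otimes\mathcal H')$ whenever $\phi\in\mathcal S(\mathcal H)$ and $\psi\in\mathcal S(\mathcal H')$, and to each pair of systems a set $\mathcal O(\mathcal H\to\mathcal H')$ of completely positive trace-preserving maps, the free operations, compact in the bounded weak topology and mapping $\mathcal S(\mathcal H)$ into $\mathcal S(\mathcal H')$; free operations are closed under composition and tensor products and include all identity maps and all traces $\mathcal H\to\mathbb C$. Put $\mathcal H^{\otimes 0}=\mathbb C$ and $\phi^{\otimes 0}=1$. A state $\psi\in\mathcal S(\mathcal H)$ is *free* if for every system $\mathcal H'$ and every $\phi\in\mathcal S(\mathcal H')$ there is $\mathcal N\in\mathcal O(\mathcal H'\to\mathcal H)$ with $\mathcal N(\phi)=\psi$. It is *maximally resourceful* if for every $\phi\in\mathcal S(\mathcal H)$ that some element of $\mathcal O(\mathcal H\to\mathcal H)$ maps to $\psi$,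 some element of $\mathcal O(\mathcal H\to\mathcal H)$ maps $\psi$ to $\phi$. The conversion rate $r_{\mathrm{conv}}(\phi\to\psi)\in[0,\infty]$ is the supremum of all $r\ge 0$ for which there are $\mathcal N_n\in\mathcal O(\mathcal H_1^{\otimes n}\to\mathcal H_2^{\otimes\lceil rn\rceil})$, $n\in\mathbb N$, with $\liminf_{n\to\infty}\|\mathcal N_n(\phi^{\otimes n})-\psi^{\otimes\lceil rn\rceil}\|_1=0$. A state $\psi$ is *catalytically replicable* if it is not free and $r_{\mathrm{conv}}(\psi\to\psi)=\infty$. Given normalization constants $R_{\max}^{(\mathcal H)}\ge 0$, put $$R_{\mathrm D}(\psi)=\inf_{\phi\in\mathcal S(\mathcal H)} r_{\mathrm{conv}}(\psi\to\phi)\,R_{\max}^{(\mathcal H)},\qquad R_{\mathrm C}(\psi)=\inf_{\phi\in\mathcal S(\mathcal H)}\frac{R_{\max}^{(\mathcal H)}}{r_{\mathrm{conv}}(\phi\to\psi)}$$ in $[0,\infty]$ (with $0\cdot\infty=0/0=0$, and $a/0=\infty$ for $a>0$). A *resource measure* is a family of functions $R_{\mathcal H}:\mathcal S(\mathcal H)\to\mathbb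 R$ with $R_{\mathcal H'}(\mathcal N(\psi))\le R_{\mathcal H}(\psi)$ for all $\psi\in\mathcal S(\mathcal H)$ and $\mathcal N\in\mathcal O(\mathcal H\to\mathcal H')$. **Proposition 24 (Uniqueness Inequality).** Let $\mathcal H$ be a quantum system such that no state in $\mathcal S(\mathcal H)$ is catalytically replicable. Let $R$ be a resource measure that satisfies, for $\mathcal H$, * conventional normalization: $R_{\mathcal H}(\sigma)=0$ for every free state $\sigma\in\mathcal S(\mathcal H)$, and $R_{\mathcal H}(\phi)=R_{\max}^{(\mathcal H)}$ for every maximally resourceful state $\phi\in\mathcal S(\mathcal H)$; * asymptotic continuity: for all positive integers $(n_i)_{i\in\mathbb N}$ and all $\phi_i,\psi_i\in\mathcal S(\mathcal H^{\otimes n_i})$ with $\|\phi_i-\psi_i\|_1\to 0$, one has $|R_{\mathcal H^{\otimes n_i}}(\phi_i)-R_{\mathcal H^{\otimes n_i}}(\psi_i)|/n_i\to 0$; * weak additivity: $R_{\mathcal H^{\otimes n}}(\psi^{\otimes n})=n\,R_{\mathcal H}(\psi)$ for all $\psi\in\mathcal S(\mathcal H)$ and all integers $n\ge 1$. Then $R_{\mathrm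 D}(\psi)\le R_{\mathcal H}(\psi)\le R_{\mathrm C}(\psi)$ for every $\psi\in\mathcal S(\mathcal H)$. -/

import Mathlib

open scoped ComplexOrder InnerProductSpace TensorProduct ENNReal NNReal Topology

universe u v

namespace QRT

/-! ### Operators on a complex Hilbert space: trace, trace norm, trace class, density operators -/

section Operators

variable (H : Type u) [NormedAddCommGroup H] [InnerProductSpace ℂ H] [CompleteSpace H]

/-- Bounded operators on `H`. -/
abbrev Op : Type u := H →L[ℂ] H

/-- An index set of an orthonormal basis of `H` (possibly uncountable). -/
noncomputable def basisIndex : Set H := (exists_hilbertBasis ℂ H).choose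

/-- An orthonormal basis of `H`, fixed once and for all; traces do not depend on it. -/
noncomputable def basis : HilbertBasis (basisIndex H) ℂ H :=
  (exists_hilbertBasis ℂ H).choose_spec.choose

variable {H}

/-- The trace `∑ₖ ⟨k|P|k⟩ ∈ [0, ∞]` of a positive operator. -/
noncomputable def posTrace (P : Op H) : ℝ≥0∞ :=
  ∑' k, ENNReal.ofReal (RCLike.re ⟪basis H k, P (basis H k)⟫_ℂ)

/-- The trace norm `‖T‖₁ = tr |T|` with `|T| = √(T† T)`; it is `∞` if `T` is not trace class. -/
noncomputable def traceNorm (T : Op H) : ℝ≥0∞ := posTrace (CFC.abs T)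

/-- The trace `∑ₖ ⟨k|T|k⟩` of a trace-class operator. -/
noncomputable def trace (T : Op H) : ℂ := ∑' k, ⟪basis H k, T (basis H k)⟫_ℂ

variable (H)

/-- The trace-class operators: the linear span of the positive operators of finite trace. -/
def traceClass : Submodule ℂ (Op H) :=
  Submodule.span ℂ {P : Op H | P.IsPositive ∧ posTrace P < ∞}

/-- The density operators: positive trace-class operators of trace one. -/
def densityOperators : Set (Op H) :=
  {ρ | ρ.IsPositive ∧ ρ ∈ traceClass H ∧ trace ρ = 1}

/-- The trace norm topology: the topology generated by the open balls `{T' | ‖T' - T‖₁ < ε}`. -/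
@[reducible] def traceNormTopology : TopologicalSpace (Op H) :=
  TopologicalSpace.generateFrom
    {U | ∃ (T : Op H) (ε : ℝ≥0∞), U = {T' : Op H | traceNorm (T' - T) < ε}}

end Operators

/-! ### Channels (completely positive trace-preserving maps) -/

section Channels

variable (H : Type u) [NormedAddCommGroup H] [InnerProductSpace ℂ H] [CompleteSpace H]
variable (K : Type u) [NormedAddCommGroup K] [InnerProductSpace ℂ K] [CompleteSpace K]
variable (L : Type u) [NormedAddCommGroup L] [InnerProductSpace ℂ L] [CompleteSpace L]

/-- A channel from `H` to `K` in the Schrödinger picture: a linear map on trace-class operators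
that is completely positive (each amplification `id ⊗ E` to `n × n` block operators maps
positive block operators to positive ones) and trace preserving. -/
@[ext]
structure Channel where
  /-- the underlying linear map -/
  map : traceClass H →ₗ[ℂ] traceClass K
  completelyPositive : ∀ (n : ℕ) (T : Fin n → Fin n → traceClass H),
    (∀ x : Fin n → H, 0 ≤ ∑ i, ∑ j, ⟪x i, (T i j : Op H) (x j)⟫_ℂ) →
    ∀ y : Fin n → K, 0 ≤ ∑ i, ∑ j, ⟪y i, (map (T i j) : Op K) (y j)⟫_ℂ
  tracePreserving : ∀ T : traceClass H, trace (map T : Op K) = trace (T : Op H)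

variable {H K L}

open Classical in
/-- The output operator `E(T)` of a channel for a trace-class operator `T`
(and `0` if `T` is not trace class). -/
noncomputable def Channel.app (E : Channel H K) (T : Op H) : Op K :=
  if h : T ∈ traceClass H then (E.map ⟨T, h⟩ : Op K) else 0

/-- The identity channel. -/
def Channel.id (H : Type u) [NormedAddCommGroup H] [InnerProductSpace ℂ H] [CompleteSpace H] :
    Channel H H where
  map := LinearMap.id
  completelyPositive := fun _ _ h => h
  tracePreserving := fun _ => rfl

/-- The composition `F ∘ E` of channels. -/
def Channel.comp (F : Channel K L) (E : Channel H K) : Channel H L where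
  map := F.map.comp E.map
  completelyPositive := fun n T h =>
    F.completelyPositive n (fun i j => E.map (T i j)) (E.completelyPositive n T h)
  tracePreserving := fun T => (F.tracePreserving (E.map T)).trans (E.tracePreserving T)

/-- The bounded weak topology on channels: the coarsest topology for which `E ↦ tr (E(T) M)` is
continuous for every trace-class `T` and every bounded `M`. -/
noncomputable instance Channel.boundedWeakTopology : TopologicalSpace (Channel H K) :=
  TopologicalSpace.induced
    (fun (E : Channel H K) (p : traceClass H × Op K) => trace ((E.map p.1 : Op K) * p.2))
    inferInstance

end Channels

/-! ### Quantum systems and their composition -/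

/-- The Hilbert space tensor product: the completion of the algebraic tensor product. -/
abbrev HTensor (H K : Type u) [NormedAddCommGroup H] [InnerProductSpace ℂ H]
    [NormedAddCommGroup K] [InnerProductSpace ℂ K] : Type u :=
  UniformSpace.Completion (H ⊗[ℂ] K)

/-- A collection of quantum systems: each system `A` is represented by a complex Hilbert space
`space A` of arbitrary dimension, there is a trivial system represented by `ℂ`, and any two
systems have a composite system represented by the tensor product of their Hilbert spaces.
All complex Hilbert spaces form such a collection; a system may also carry further
structure, such as a distinguished basis or a bipartition. -/
structure QuantumSystems where
  /-- the systems -/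
  Sys : Type v
  /-- the Hilbert space of a system -/
  space : Sys → Type u
  [normed : ∀ A, NormedAddCommGroup (space A)]
  [innerProduct : ∀ A, InnerProductSpace ℂ (space A)]
  [complete : ∀ A, CompleteSpace (space A)]
  /-- the trivial system -/
  unit : Sys
  /-- the trivial system is represented by `ℂ` -/
  unitIso : space unit ≃ₗᵢ[ℂ] ℂ
  /-- the composite of two systems -/
  tensor : Sys → Sys → Sys
  /-- composite systems are represented by tensor products -/
  tensorIso : ∀ A B, space (tensor A B) ≃ₗᵢ[ℂ] HTensor (space A) (space B)

attribute [instance] QuantumSystems.normed QuantumSystems.innerProduct QuantumSystems.complete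

namespace QuantumSystems

variable (𝒬 : QuantumSystems.{u, v})

/-- The `n`-fold power of a system: `A^{⊗0} = ℂ`, `A^{⊗1} = A`, `A^{⊗(n+1)} = A^{⊗n} ⊗ A`. -/
def pow (A : 𝒬.Sys) : ℕ → 𝒬.Sys
  | 0 => 𝒬.unit
  | 1 => A
  | n + 2 => 𝒬.tensor (pow A (n + 1)) A

variable {𝒬}

/-- The operator `ρ ⊗ σ` on a composite system. -/
noncomputable def opTensor {A B : 𝒬.Sys} (ρ : Op (𝒬.space A)) (σ : Op (𝒬.space B)) :
    Op (𝒬.space (𝒬.tensor A B)) :=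
  ((𝒬.tensorIso A B).symm.toContinuousLinearEquiv : _ →L[ℂ] _) ∘L
    (TensorProduct.mapL ρ σ).completion ∘L
    ((𝒬.tensorIso A B).toContinuousLinearEquiv : _ →L[ℂ] _)

/-- The operator `ρ^{⊗n}`, with `ρ^{⊗0} = 1` on the trivial system. -/
noncomputable def opPow {A : 𝒬.Sys} (ρ : Op (𝒬.space A)) :
    (n : ℕ) → Op (𝒬.space (𝒬.pow A n))
  | 0 => (1 : Op (𝒬.space 𝒬.unit))
  | 1 => ρ
  | n + 2 => opTensor (opPow ρ (n + 1)) ρ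

end QuantumSystems

open QuantumSystems

/-! ### Quantum resource theories -/

/-- A quantum resource theory on a collection of quantum systems: a compact set of states of
interest for each system and a compact set of free operations for each pair of systems, such
that free operations compose, can be applied in parallel, and include doing nothing and
discarding the system. -/
structure ResourceTheory (𝒬 : QuantumSystems.{u, v}) where
  /-- the set `𝒮(A)` of states of interest -/
  states : ∀ A : 𝒬.Sys, Set (Op (𝒬.space A))
  states_subset : ∀ A, states A ⊆ densityOperators (𝒬.space A)
  states_compact : ∀ A, @IsCompact _ (traceNormTopology (𝒬.space A)) (states A)
  states_tensor : ∀ {A B : 𝒬.Sys} {ρ : Op (𝒬.space A)} {σ : Op (𝒬.space B)},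
    ρ ∈ states A → σ ∈ states B → opTensor ρ σ ∈ states (𝒬.tensor A B)
  /-- the set `𝒪(A → B)` of free operations -/
  free : ∀ A B : 𝒬.Sys, Set (Channel (𝒬.space A) (𝒬.space B))
  free_compact : ∀ A B, IsCompact (free A B)
  free_maps : ∀ {A B : 𝒬.Sys}, ∀ E ∈ free A B, ∀ ρ ∈ states A, E.app ρ ∈ states B
  free_comp : ∀ {A B C : 𝒬.Sys}, ∀ E ∈ free A B, ∀ F ∈ free B C, F.comp E ∈ free A C
  /-- `E ⊗ F` is free; it is the only channel with `(E ⊗ F)(ρ ⊗ σ) = E(ρ) ⊗ F(σ)`. -/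
  free_tensor : ∀ {A A' B B' : 𝒬.Sys}, ∀ E ∈ free A A', ∀ F ∈ free B B',
    ∃ G ∈ free (𝒬.tensor A B) (𝒬.tensor A' B'),
      ∀ ρ ∈ traceClass (𝒬.space A), ∀ σ ∈ traceClass (𝒬.space B),
        G.app (opTensor ρ σ) = opTensor (E.app ρ) (F.app σ)
  free_id : ∀ A, Channel.id (𝒬.space A) ∈ free A A
  free_trace : ∀ A, ∃ E ∈ free A 𝒬.unit, ∀ ρ ∈ traceClass (𝒬.space A), E.app ρ = trace ρ • 1

namespace ResourceTheory

variable {𝒬 : QuantumSystems.{u, v}} (𝒯 : ResourceTheory 𝒬)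

/-- Tensor powers of states are states. -/
theorem opPow_mem {A : 𝒬.Sys} {ρ : Op (𝒬.space A)} (hρ : ρ ∈ 𝒯.states A) :
    ∀ n : ℕ, 0 < n → opPow ρ n ∈ 𝒯.states (𝒬.pow A n)
  | 0, h => absurd h (lt_irrefl 0)
  | 1, _ => hρ
  | n + 2, _ => 𝒯.states_tensor (opPow_mem hρ (n + 1) n.succ_pos) hρ

/-- The preorder `φ ⪰ ψ` on operators of one system: some free operation maps `φ` to `ψ`. -/
def Converts {A : 𝒬.Sys} (φ ψ : Op (𝒬.space A)) : Prop :=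
  ∃ E ∈ 𝒯.free A A, E.app φ = ψ

/-- The set `𝒢(A)` of maximally resourceful states. -/
def maximalStates (A : 𝒬.Sys) : Set (Op (𝒬.space A)) :=
  {φ | φ ∈ 𝒯.states A ∧ ∀ ψ ∈ 𝒯.states A, 𝒯.Converts ψ φ → 𝒯.Converts φ ψ}

/-- The set `ℱ(A)` of free states: those obtainable from every state of every system. -/
def freeStates (A : 𝒬.Sys) : Set (Op (𝒬.space A)) :=
  {ψ | ψ ∈ 𝒯.states A ∧ ∀ B : 𝒬.Sys, ∀ φ ∈ 𝒯.states B, ∃ E ∈ 𝒯.free B A, ψ = E.app φ}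

/-- The set of asymptotically achievable rates of conversion from `φ` to `ψ`. -/
def achievableRates {A B : 𝒬.Sys} (φ : Op (𝒬.space A)) (ψ : Op (𝒬.space B)) : Set ℝ≥0 :=
  {r | ∃ N : ∀ n : ℕ, Channel (𝒬.space (𝒬.pow A n)) (𝒬.space (𝒬.pow B ⌈r * n⌉₊)),
    (∀ n, N n ∈ 𝒯.free (𝒬.pow A n) (𝒬.pow B ⌈r * n⌉₊)) ∧
    Filter.liminf
      (fun n : ℕ => traceNorm ((N n).app (opPow φ n) - opPow ψ ⌈r * n⌉₊)) Filter.atTop = 0}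

/-- The asymptotic conversion rate `r_conv(φ → ψ) ∈ [0, ∞]`. -/
noncomputable def convRate {A B : 𝒬.Sys} (φ : Op (𝒬.space A)) (ψ : Op (𝒬.space B)) : ℝ≥0∞ :=
  ⨆ r ∈ 𝒯.achievableRates φ ψ, (r : ℝ≥0∞)

/-- Catalytically replicable states: not free, but with infinite replication rate. -/
def CatalyticallyReplicable {A : 𝒬.Sys} (ψ : Op (𝒬.space A)) : Prop :=
  ψ ∈ 𝒯.states A ∧ ψ ∉ 𝒯.freeStates A ∧ 𝒯.convRate ψ ψ = ∞

/-- The distillable resource `R_D(ψ) ∈ [0, ∞]`, with normalization constants `Rmax`. -/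
noncomputable def distillable (Rmax : 𝒬.Sys → ℝ≥0) {A : 𝒬.Sys} (ψ : Op (𝒬.space A)) : ℝ≥0∞ :=
  ⨅ φ ∈ 𝒯.states A, 𝒯.convRate ψ φ * Rmax A

/-- The resource cost `R_C(ψ) ∈ [0, ∞]`, with normalization constants `Rmax`. -/
noncomputable def cost (Rmax : 𝒬.Sys → ℝ≥0) {A : 𝒬.Sys} (ψ : Op (𝒬.space A)) : ℝ≥0∞ :=
  ⨅ φ ∈ 𝒯.states A, (Rmax A : ℝ≥0∞) / 𝒯.convRate φ ψ

/-- A resource measure: a family of real functions on the states of each system that does not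
increase under free operations. -/
structure Measure where
  /-- the value of the measure on a state of a system -/
  val : ∀ A : 𝒬.Sys, 𝒯.states A → ℝ
  monotone : ∀ (A B : 𝒬.Sys) (ψ : 𝒯.states A) (E : Channel (𝒬.space A) (𝒬.space B))
    (hE : E ∈ 𝒯.free A B), val B ⟨E.app ψ, 𝒯.free_maps E hE ψ ψ.2⟩ ≤ val A ψ

namespace Measure

variable {𝒯} (R : 𝒯.Measure) (A : 𝒬.Sys)

/-- Conventional normalization on the system `A`: free states have value `0` and maximally
resourceful states have value `Rmax A`. -/
def ConventionallyNormalized (Rmax : 𝒬.Sys → ℝ≥0) : Prop :=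
  (∀ σ : 𝒯.states A, (σ : Op (𝒬.space A)) ∈ 𝒯.freeStates A → R.val A σ = 0) ∧
  (∀ φ : 𝒯.states A, (φ : Op (𝒬.space A)) ∈ 𝒯.maximalStates A → R.val A φ = Rmax A)

/-- Asymptotic continuity for the system `A`. -/
def AsymptoticallyContinuous : Prop :=
  ∀ (n : ℕ → ℕ), (∀ i, 0 < n i) →
    ∀ (φ ψ : ∀ i, 𝒯.states (𝒬.pow A (n i))),
      Filter.Tendsto (fun i => traceNorm ((φ i).1 - (ψ i).1))
        Filter.atTop (𝓝 0) →
      Filter.Tendsto (fun i => |R.val _ (φ i) - R.val _ (ψ i)| / (n i : ℝ)) Filter.atTop (𝓝 0)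

/-- Weak additivity for the system `A`. -/
def WeaklyAdditive : Prop :=
  ∀ (ψ : 𝒯.states A) (n : ℕ) (hn : 0 < n),
    R.val (𝒬.pow A n) ⟨opPow (ψ : Op (𝒬.space A)) n, 𝒯.opPow_mem ψ.2 n hn⟩ = n * R.val A ψ

end Measure

end ResourceTheory

end QRT

namespace QRT

/-! ### Traces and quadratic forms of positive operators. -/

section Operators

variable {H : Type u} [NormedAddCommGroup H] [InnerProductSpace ℂ H] [CompleteSpace H]

/-! The core is `r_conv(φ → ψ) · R(ψ) ≤ R(φ)` (`convRate_mul_val_le`): if `φ^{⊗n}` is freely mapped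
close to `ψ^{⊗m}` with `m = ⌈rn⌉`, then monotonicity, weak additivity and asymptotic continuity give
`m R(ψ) - o(m) ≤ n R(φ)`, hence `r R(ψ) ≤ R(φ)`. Both bounds then need maximally resourceful states.
Each state is obtainable from one (`exists_maximalStates_converts`), by Zorn's lemma and compactness
of states and of free operations. With a maximal target, the core inequality bounds `R_D(ψ)` by
`R(ψ)`. By monotonicity `R ≤ Rmax` everywhere, so `r_conv(φ → ψ) · R(ψ) ≤ Rmax` for all `φ`, which
is the bound by `R_C(ψ)`. -/

theorem posTrace_add {P Q : Op H} (hP : P.IsPositive) (hQ : Q.IsPositive) :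
    posTrace (P + Q) = posTrace P + posTrace Q := by
  unfold posTrace
  rw [← ENNReal.tsum_add]
  refine tsum_congr fun k => ?_
  rw [add_apply, inner_add_right, map_add,
    ENNReal.ofReal_add (hP.re_inner_nonneg_right _) (hQ.re_inner_nonneg_right _)]

/-- The diagonal of a trace-class operator is summable. -/
theorem summable_inner_basis {T : Op H} (hT : T ∈ traceClass H) :
    Summable fun k => ⟪basis H k, T (basis H k)⟫_ℂ := by
  induction hT using Submodule.span_induction with
  | mem P hP =>
    obtain ⟨hpos, hfin⟩ := hP
    have hs : Summable fun k => (ENNReal.ofReal (RCLike.re ⟪basis H k, P (basis H k)⟫_ℂ)).toReal :=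
      ENNReal.summable_toReal hfin.ne
    refine (Complex.hasSum_ofReal.mpr hs.hasSum).summable.congr fun k => ?_
    rw [ENNReal.toReal_ofReal (hpos.re_inner_nonneg_right _)]
    exact (Complex.eq_re_of_ofReal_le (hpos.inner_nonneg_right (basis H k))).symm
  | zero => simp
  | add S T _ _ hS hT => simpa [inner_add_right] using hS.add hT
  | smul c T _ hT => simpa [inner_smul_right] using hT.mul_left c

theorem posTrace_eq_trace {P : Op H} (hP : P.IsPositive) (hPt : P ∈ traceClass H) :
    posTrace P = ENNReal.ofReal (trace P).re := by
  have hs := summable_inner_basis hPt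
  have h := Complex.hasSum_re hs.hasSum
  unfold posTrace trace
  rw [← h.tsum_eq, ENNReal.ofReal_tsum_of_nonneg _ h.summable]
  · rfl
  · exact fun k => hP.re_inner_nonneg_right _

theorem ofReal_norm_sq_eq_tsum (x : H) :
    ENNReal.ofReal (‖x‖ ^ 2) = ∑' k, ENNReal.ofReal (‖⟪basis H k, x⟫_ℂ‖ ^ 2) := by
  have h := Complex.hasSum_re ((basis H).hasSum_inner_mul_inner x x)
  have h' : HasSum (fun k => ‖⟪basis H k, x⟫_ℂ‖ ^ 2) (‖x‖ ^ 2) := by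
    convert h using 1
    · funext k
      rw [← inner_conj_symm x, ← Complex.normSq_eq_conj_mul_self, Complex.ofReal_re,
        Complex.normSq_eq_norm_sq]
    · rw [inner_self_eq_norm_sq_to_K]
      norm_cast
  rw [← h'.tsum_eq, ENNReal.ofReal_tsum_of_nonneg (fun _ => by positivity) h'.summable]

/-- The operator norm of a positive operator is at most its trace. With `P = S²`, Parseval expands
`‖S x‖²`; moving `S` onto the basis vectors and applying Cauchy–Schwarz bounds each term. -/
theorem inner_le_posTrace_mul {P : Op H} (hP : P.IsPositive) (x : H) :
    ENNReal.ofReal (RCLike.re ⟪x, P x⟫_ℂ) ≤ posTrace P * ENNReal.ofReal (‖x‖ ^ 2) := by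
  have hP0 : 0 ≤ P := (ContinuousLinearMap.nonneg_iff_isPositive P).mpr hP
  set S : Op H := CFC.sqrt P with hS
  have hSS : S * S = P := CFC.sqrt_mul_sqrt_self P hP0
  have hsymm := ((ContinuousLinearMap.nonneg_iff_isPositive S).mp
    (CFC.sqrt_nonneg P)).inner_left_eq_inner_right
  have key : ∀ y : H, RCLike.re ⟪y, P y⟫_ℂ = ‖S y‖ ^ 2 := fun y => by
    rw [← hSS, mul_apply_eq_comp, ← hsymm, inner_self_eq_norm_sq]
  rw [key, ofReal_norm_sq_eq_tsum, posTrace, ← ENNReal.tsum_mul_right]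
  refine ENNReal.tsum_le_tsum fun k => ?_
  rw [← ENNReal.ofReal_mul (hP.re_inner_nonneg_right _), key]
  refine ENNReal.ofReal_le_ofReal ?_
  rw [← hsymm, ← mul_pow]
  exact pow_le_pow_left₀ (norm_nonneg _) (norm_inner_le_norm _ _) 2

theorem traceNorm_zero : traceNorm (0 : Op H) = 0 := by
  simp [traceNorm, posTrace]

theorem tendsto_traceNorm_sub {ι : Type*} {l : Filter ι} {f : ι → Op H} {T : Op H}
    (h : Filter.Tendsto f l (@nhds _ (traceNormTopology H) T)) :
    Filter.Tendsto (fun i => traceNorm (f i - T)) l (𝓝 0) := by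
  rw [ENNReal.tendsto_nhds_zero]
  intro ε hε
  have hU : @IsOpen _ (traceNormTopology H) {T' : Op H | traceNorm (T' - T) < ε} :=
    TopologicalSpace.isOpen_generateFrom_of_mem ⟨T, ε, rfl⟩
  have hmem : {T' : Op H | traceNorm (T' - T) < ε} ∈ @nhds _ (traceNormTopology H) T :=
    @IsOpen.mem_nhds _ (traceNormTopology H) _ _ hU (by simpa [traceNorm_zero] using hε)
  filter_upwards [h hmem] with i hi using le_of_lt hi

/-- Rank-one observables let the bounded weak topology control quadratic forms of outputs. -/
theorem trace_mul_rankOne (T : Op H) (x : H) :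
    trace (T * InnerProductSpace.rankOne ℂ x x) = ⟪x, T x⟫_ℂ := by
  rw [← (basis H).tsum_inner_mul_inner x (T x)]
  refine tsum_congr fun k => ?_
  simp

end Operators

/-! ### Positivity and continuity estimates for channels. -/

section Channels

variable {H : Type u} [NormedAddCommGroup H] [InnerProductSpace ℂ H] [CompleteSpace H]
variable {K : Type u} [NormedAddCommGroup K] [InnerProductSpace ℂ K] [CompleteSpace K]
variable {L : Type u} [NormedAddCommGroup L] [InnerProductSpace ℂ L] [CompleteSpace L]

theorem Channel.app_of_mem (E : Channel H K) {T : Op H} (h : T ∈ traceClass H) :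
    E.app T = E.map ⟨T, h⟩ := dif_pos h

theorem Channel.comp_app (F : Channel K L) (E : Channel H K) (T : Op H) :
    (F.comp E).app T = F.app (E.app T) := by
  by_cases h : T ∈ traceClass H
  · rw [app_of_mem _ h, app_of_mem _ h, app_of_mem _ (E.map ⟨T, h⟩).2]
    rfl
  · have h0 : F.app 0 = 0 := by
      rw [app_of_mem _ (zero_mem _)]
      exact congrArg Subtype.val (map_zero F.map)
    have hE : E.app T = 0 := dif_neg h
    rw [hE, h0]
    exact dif_neg h

theorem Channel.app_isPositive (E : Channel H K) {P : Op H} (hP : P.IsPositive)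
    (hPt : P ∈ traceClass H) : (E.app P).IsPositive := by
  rw [app_of_mem E hPt, ContinuousLinearMap.isPositive_iff_complex]
  intro y
  have h := E.completelyPositive 1 (fun _ _ => ⟨P, hPt⟩)
    (fun x => by simpa using hP.inner_nonneg_right (x 0)) (fun _ => y)
  have h' : 0 ≤ ⟪y, (E.map ⟨P, hPt⟩ : Op K) y⟫_ℂ := by simpa using h
  rw [Complex.nonneg_iff] at h'
  rw [← inner_conj_symm]
  refine ⟨Complex.ext (by simp) ?_, ?_⟩
  · rw [Complex.ofReal_im, Complex.conj_im, ← h'.2, neg_zero]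
  · rw [RCLike.conj_re]
    exact h'.1

theorem Channel.posTrace_app (E : Channel H K) {P : Op H} (hP : P.IsPositive)
    (hPt : P ∈ traceClass H) : posTrace (E.app P) = posTrace P := by
  have hm : E.app P ∈ traceClass K := by
    rw [app_of_mem E hPt]; exact Subtype.prop _
  rw [posTrace_eq_trace (E.app_isPositive hP hPt) hm, posTrace_eq_trace hP hPt,
    app_of_mem E hPt, E.tracePreserving]

theorem Channel.app_sub (E : Channel H K) {S T : Op H} (hS : S ∈ traceClass H)
    (hT : T ∈ traceClass H) : E.app (S - T) = E.app S - E.app T := by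
  rw [app_of_mem E hS, app_of_mem E hT, app_of_mem E (sub_mem hS hT)]
  exact congrArg Subtype.val (map_sub E.map ⟨S, hS⟩ ⟨T, hT⟩)

/-- The quadratic form of the output of a channel is controlled by the trace norm of a
self-adjoint input. -/
theorem Channel.norm_inner_app_le (E : Channel H K) {D : Op H} (hD : IsSelfAdjoint D)
    (hfin : traceNorm D < ∞) (y : K) :
    ENNReal.ofReal ‖⟪y, E.app D y⟫_ℂ‖ ≤ traceNorm D * ENNReal.ofReal (‖y‖ ^ 2) := by
  -- Jordan decomposition: `|D| = D⁺ + D⁻`, and the channel preserves positivity and trace of each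
  -- part.
  have hP := (ContinuousLinearMap.nonneg_iff_isPositive _).mp (CFC.posPart_nonneg D)
  have hN := (ContinuousLinearMap.nonneg_iff_isPositive _).mp (CFC.negPart_nonneg D)
  have hadd := CFC.posPart_add_negPart D hD
  have hsub := CFC.posPart_sub_negPart D hD
  have htr : traceNorm D = posTrace D⁺ + posTrace D⁻ := by
    rw [traceNorm, ← hadd, posTrace_add hP hN]
  rw [htr, ENNReal.add_lt_top] at hfin
  have hPt : D⁺ ∈ traceClass H := Submodule.subset_span ⟨hP, hfin.1⟩
  have hNt : D⁻ ∈ traceClass H := Submodule.subset_span ⟨hN, hfin.2⟩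
  have hEP := E.app_isPositive hP hPt
  have hEN := E.app_isPositive hN hNt
  have hE : E.app D = E.app D⁺ - E.app D⁻ := by rw [← E.app_sub hPt hNt, hsub]
  have hn : ∀ {Q : Op K}, Q.IsPositive → ‖⟪y, Q y⟫_ℂ‖ = RCLike.re ⟪y, Q y⟫_ℂ := fun hQ =>
    (Complex.re_eq_norm.mpr (hQ.inner_nonneg_right y)).symm
  calc ENNReal.ofReal ‖⟪y, E.app D y⟫_ℂ‖
      ≤ ENNReal.ofReal (RCLike.re ⟪y, E.app D⁺ y⟫_ℂ + RCLike.re ⟪y, E.app D⁻ y⟫_ℂ) := by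
        refine ENNReal.ofReal_le_ofReal ?_
        rw [hE, sub_apply, inner_sub_right, ← hn hEP, ← hn hEN]
        exact norm_sub_le _ _
    _ ≤ posTrace (E.app D⁺) * ENNReal.ofReal (‖y‖ ^ 2)
        + posTrace (E.app D⁻) * ENNReal.ofReal (‖y‖ ^ 2) := by
        rw [ENNReal.ofReal_add (hEP.re_inner_nonneg_right _) (hEN.re_inner_nonneg_right _)]
        exact add_le_add (inner_le_posTrace_mul hEP y) (inner_le_posTrace_mul hEN y)
    _ = _ := by rw [E.posTrace_app hP hPt, E.posTrace_app hN hNt, htr, add_mul]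

theorem Channel.id_app {T : Op H} (h : T ∈ traceClass H) : (Channel.id H).app T = T :=
  (Channel.id H).app_of_mem h

theorem Channel.tendsto_inner_app {ι : Type*} {l : Filter ι} {F : ι → Channel H K}
    {E : Channel H K} (h : Filter.Tendsto F l (𝓝 E)) {T : Op H} (hT : T ∈ traceClass H) (y : K) :
    Filter.Tendsto (fun i => ⟪y, (F i).app T y⟫_ℂ) l (𝓝 ⟪y, E.app T y⟫_ℂ) := by
  have hc : Continuous fun (E : Channel H K) (p : traceClass H × Op K) =>
      trace ((E.map p.1 : Op K) * p.2) := continuous_induced_dom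
  have hc' := (continuous_apply
    ((⟨T, hT⟩, InnerProductSpace.rankOne ℂ y y) : traceClass H × Op K)).comp hc
  simpa only [trace_mul_rankOne, Function.comp_def, app_of_mem _ hT] using (hc'.tendsto E).comp h

end Channels

end QRT

namespace QRT

open QuantumSystems Filter

/-! ### The conversion preorder and existence of maximally resourceful states. -/

namespace ResourceTheory

variable {𝒬 : QuantumSystems.{u, v}} {𝒯 : ResourceTheory 𝒬} {A : 𝒬.Sys}

theorem mem_traceClass {ρ : Op (𝒬.space A)} (h : ρ ∈ 𝒯.states A) :
    ρ ∈ traceClass (𝒬.space A) := (𝒯.states_subset A h).2.1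

theorem Converts.refl {ρ : Op (𝒬.space A)} (h : ρ ∈ 𝒯.states A) : 𝒯.Converts ρ ρ :=
  ⟨_, 𝒯.free_id A, Channel.id_app (mem_traceClass h)⟩

theorem Converts.trans {ρ σ τ : Op (𝒬.space A)} (h₁ : 𝒯.Converts ρ σ) (h₂ : 𝒯.Converts σ τ) :
    𝒯.Converts ρ τ := by
  obtain ⟨E, hE, rfl⟩ := h₁
  obtain ⟨F, hF, rfl⟩ := h₂
  exact ⟨_, 𝒯.free_comp E hE F hF, Channel.comp_app F E ρ⟩

/-- The states convertible to a fixed state are closed under limits along ultrafilters. -/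
theorem converts_of_tendsto {ι : Type*} {𝒰 : Ultrafilter ι} {f : ι → Op (𝒬.space A)}
    {ρ σ : Op (𝒬.space A)} (hf : ∀ i, f i ∈ 𝒯.states A) (hρ : ρ ∈ 𝒯.states A)
    (hlim : Tendsto f 𝒰 (@nhds _ (traceNormTopology (𝒬.space A)) ρ))
    (hconv : ∀ᶠ i in 𝒰, 𝒯.Converts (f i) σ) : 𝒯.Converts ρ σ := by
  -- Conversion holds only eventually; elsewhere the identity serves as a filler so that `F` is
  -- total.
  have hex : ∀ i, ∃ E ∈ 𝒯.free A A, 𝒯.Converts (f i) σ → E.app (f i) = σ := fun i => by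
    by_cases h : 𝒯.Converts (f i) σ
    · obtain ⟨E, hE, h'⟩ := h
      exact ⟨E, hE, fun _ => h'⟩
    · exact ⟨_, 𝒯.free_id A, fun h' => absurd h' h⟩
  choose F hF hFσ using hex
  obtain ⟨E, hE, hFE⟩ := (𝒯.free_compact A A).ultrafilter_le_nhds (𝒰.map F)
    (le_principal_iff.mpr (mem_map.mpr (Eventually.of_forall hF)))
  have hFE : Tendsto F 𝒰 (𝓝 E) := hFE
  refine ⟨E, hE, ?_⟩
  rw [← sub_eq_zero, ← ContinuousLinearMap.coe_inj]
  -- On a complex space the quadratic form determines the operator.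
  refine inner_map_self_eq_zero _ |>.mp fun y => ?_
  have h1 := Channel.tendsto_inner_app hFE (mem_traceClass hρ) y
  have hn := tendsto_traceNorm_sub hlim
  have hfin : ∀ᶠ i in (𝒰 : Filter ι), traceNorm (f i - ρ) < ∞ :=
    hn.eventually (gt_mem_nhds ENNReal.zero_lt_top)
  have h2 : Tendsto (fun i => ENNReal.ofReal ‖⟪y, (F i).app (f i - ρ) y⟫_ℂ‖) 𝒰 (𝓝 0) := by
    have hb : Tendsto (fun i => traceNorm (f i - ρ) * ENNReal.ofReal (‖y‖ ^ 2)) 𝒰 (𝓝 0) := by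
      have := ENNReal.Tendsto.mul_const (b := ENNReal.ofReal (‖y‖ ^ 2)) hn
        (Or.inr ENNReal.ofReal_ne_top)
      rwa [zero_mul] at this
    refine tendsto_of_tendsto_of_tendsto_of_le_of_le' tendsto_const_nhds hb
      (Eventually.of_forall fun _ => zero_le) ?_
    filter_upwards [hfin] with i hi
    exact (F i).norm_inner_app_le
      ((𝒯.states_subset A (hf i)).1.isSelfAdjoint.sub (𝒯.states_subset A hρ).1.isSelfAdjoint) hi y
  have h3 : Tendsto (fun i => ⟪y, (F i).app (f i - ρ) y⟫_ℂ) 𝒰 (𝓝 0) := by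
    rw [tendsto_zero_iff_norm_tendsto_zero]
    simpa [Function.comp_def] using (ENNReal.tendsto_toReal ENNReal.zero_ne_top).comp h2
  -- Eventually `F i (ρ) = σ - F i (f i - ρ)`, and the error vanishes by a bound uniform over
  -- channels.
  have h4 : Tendsto (fun i => ⟪y, (F i).app ρ y⟫_ℂ) 𝒰 (𝓝 ⟪y, σ y⟫_ℂ) := by
    have h5 : Tendsto (fun i => ⟪y, σ y⟫_ℂ - ⟪y, (F i).app (f i - ρ) y⟫_ℂ) 𝒰
        (𝓝 (⟪y, σ y⟫_ℂ - 0)) := tendsto_const_nhds.sub h3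
    rw [sub_zero] at h5
    refine h5.congr' ?_
    filter_upwards [hconv] with i hi
    rw [(F i).app_sub (mem_traceClass (hf i)) (mem_traceClass hρ), hFσ i hi, sub_apply,
      inner_sub_right, sub_sub_cancel]
  have h6 : ⟪y, E.app ρ y⟫_ℂ = ⟪y, σ y⟫_ℂ := tendsto_nhds_unique h1 h4
  rw [← inner_conj_symm]
  simp [inner_sub_right, h6]

/-- Every state can be obtained from a maximally resourceful state by a free operation. -/
theorem exists_maximalStates_converts {ψ : Op (𝒬.space A)} (hψ : ψ ∈ 𝒯.states A) :
    ∃ φ ∈ 𝒯.maximalStates A, 𝒯.Converts φ ψ := by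
  -- Zorn's lemma is applied only above `ψ`. Maximality there is global, since whatever converts to
  -- a member of `X` also converts to `ψ`.
  let X : Type u := {χ : Op (𝒬.space A) // χ ∈ 𝒯.states A ∧ 𝒯.Converts χ ψ}
  have hX : Nonempty X := ⟨⟨ψ, hψ, Converts.refl hψ⟩⟩
  have hchain : ∀ c : Set X, IsChain (fun a b => 𝒯.Converts b.1 a.1) c → c.Nonempty →
      ∃ ub : X, ∀ a ∈ c, 𝒯.Converts ub.1 a.1 := by
    intro c hc hne
    have : Nonempty c := hne.to_subtype
    -- The tail filter of the chain; an ultrafilter finer than it eventually lies above each `a`, so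
    -- its limit converts to every `a`.
    let l : Filter c := ⨅ a : c, 𝓟 {b : c | 𝒯.Converts b.1.1 a.1.1}
    have hl : l.NeBot := by
      refine iInf_neBot_of_directed' ?_ fun a => ?_
      · intro a b
        have key : ∀ a b : c, 𝒯.Converts b.1.1 a.1.1 →
            {d : c | 𝒯.Converts d.1.1 b.1.1} ⊆ {d : c | 𝒯.Converts d.1.1 a.1.1} :=
          fun a b h d hd => Converts.trans hd h
        have hab : 𝒯.Converts b.1.1 a.1.1 ∨ 𝒯.Converts a.1.1 b.1.1 := by
          by_cases h : a.1 = b.1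
          · rw [h]; exact Or.inl (Converts.refl b.1.2.1)
          · exact hc a.2 b.2 h
        rcases hab with h | h
        · exact ⟨b, principal_mono.mpr (key a b h), le_rfl⟩
        · exact ⟨a, le_rfl, principal_mono.mpr (key b a h)⟩
      · exact principal_neBot_iff.mpr ⟨a, Converts.refl a.1.2.1⟩
    let f : c → Op (𝒬.space A) := fun a => a.1.1
    obtain ⟨φ, hφ, hlim⟩ := @IsCompact.ultrafilter_le_nhds _ (traceNormTopology (𝒬.space A)) _
      (𝒯.states_compact A) ((Ultrafilter.of l).map f)
      (le_principal_iff.mpr (mem_map.mpr (Eventually.of_forall fun a : c => a.1.2.1)))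
    have hconv : ∀ a : c, 𝒯.Converts φ a.1.1 := fun a => by
      refine converts_of_tendsto (f := f) (fun b => b.1.2.1) hφ hlim ?_
      exact Ultrafilter.of_le l (mem_iInf_of_mem a (mem_principal_self _))
    obtain ⟨a⟩ := this
    exact ⟨⟨φ, hφ, (hconv a).trans a.1.2.2⟩, fun b hb => hconv ⟨b, hb⟩⟩
  obtain ⟨m, hm⟩ := exists_maximal_of_nonempty_chains_bounded hchain
    (fun h₁ h₂ => Converts.trans h₂ h₁)
  exact ⟨m.1, ⟨m.2.1, fun χ hχ h => hm ⟨χ, hχ, h.trans m.2.2⟩ h⟩, m.2.2⟩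

/-! ### Bounds on resource measures. -/

namespace Measure

variable {R : 𝒯.Measure}

/-- A weakly additive resource measure is nonnegative, because the trace is free. -/
theorem WeaklyAdditive.val_nonneg (hadd : R.WeaklyAdditive A) (ψ : 𝒯.states A) :
    0 ≤ R.val A ψ := by
  -- Discarding `ψ^{⊗n}` yields the same trivial state for every `n`, so its value is a lower bound
  -- independent of `n`.
  have key : ∃ c : ℝ, ∀ n : ℕ, 0 < n → c ≤ n * R.val A ψ := by
    have hone : (1 : Op (𝒬.space 𝒬.unit)) ∈ 𝒯.states 𝒬.unit := by
      obtain ⟨E, hE, h⟩ := 𝒯.free_trace A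
      have := 𝒯.free_maps E hE ψ ψ.2
      rwa [h _ (mem_traceClass ψ.2), (𝒯.states_subset A ψ.2).2.2, one_smul] at this
    refine ⟨R.val 𝒬.unit ⟨1, hone⟩, fun n hn => ?_⟩
    have hmem := 𝒯.opPow_mem ψ.2 n hn
    obtain ⟨E, hE, h⟩ := 𝒯.free_trace (𝒬.pow A n)
    have h1 : E.app (opPow (ψ : Op (𝒬.space A)) n) = 1 := by
      rw [h _ (mem_traceClass hmem), (𝒯.states_subset _ hmem).2.2, one_smul]
    rw [← hadd ψ n hn]
    convert R.monotone _ _ ⟨_, hmem⟩ E hE using 2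
    exact Subtype.ext h1.symm
  obtain ⟨c, hc⟩ := key
  by_contra! hneg
  obtain ⟨n, hn⟩ := exists_nat_gt (c / R.val A ψ)
  have h := hc (n + 1) n.succ_pos
  rw [div_lt_iff_of_neg hneg] at hn
  push_cast at h
  linarith

/-- An achievable conversion rate bounds the ratio of the values of the measure. -/
theorem mul_val_le_of_mem_achievableRates (hcont : R.AsymptoticallyContinuous A)
    (hadd : R.WeaklyAdditive A) (φ ψ : 𝒯.states A) {r : ℝ≥0}
    (hr : r ∈ 𝒯.achievableRates (φ : Op (𝒬.space A)) (ψ : Op (𝒬.space A))) :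
    r * R.val A ψ ≤ R.val A φ := by
  -- For `r = 0` the target powers are all `0`, outside the scope of asymptotic continuity and weak
  -- additivity.
  rcases eq_or_ne r 0 with rfl | hr0
  · simpa using hadd.val_nonneg φ
  obtain ⟨N, hN, hlim⟩ := hr
  -- A vanishing liminf gives small errors only along a subsequence, which is enough; `n > k` also
  -- keeps `n` positive.
  have hfreq : ∀ k : ℕ, ∃ n > k,
      traceNorm ((N n).app (opPow (φ : Op (𝒬.space A)) n) - opPow (ψ : Op (𝒬.space A)) ⌈r * n⌉₊)
        < ((k : ℝ≥0∞) + 1)⁻¹ := fun k => by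
    refine (frequently_atTop'.mp (frequently_lt_of_liminf_lt (by isBoundedDefault) ?_)) k
    rw [hlim, ENNReal.inv_pos]
    exact ENNReal.add_ne_top.mpr ⟨ENNReal.natCast_ne_top k, ENNReal.one_ne_top⟩
  choose n hn hlt using hfreq
  have hnpos : ∀ k, 0 < n k := fun k => (Nat.zero_le k).trans_lt (hn k)
  have hmpos : ∀ k, 0 < ⌈r * n k⌉₊ := fun k =>
    Nat.ceil_pos.mpr (mul_pos (pos_iff_ne_zero.mpr hr0) (Nat.cast_pos.mpr (hnpos k)))
  have hφn : ∀ k, opPow (φ : Op (𝒬.space A)) (n k) ∈ 𝒯.states _ := fun k =>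
    𝒯.opPow_mem φ.2 _ (hnpos k)
  have hT := hcont (fun k => ⌈r * n k⌉₊) hmpos
    (fun k => ⟨_, 𝒯.free_maps _ (hN (n k)) _ (hφn k)⟩)
    (fun k => ⟨_, 𝒯.opPow_mem ψ.2 _ (hmpos k)⟩) ?_
  · have hlim' := (hT.const_mul (r : ℝ)).const_sub (r * R.val A ψ)
    rw [mul_zero, sub_zero] at hlim'
    refine le_of_tendsto' hlim' fun k => ?_
    have hmR : (0 : ℝ) < ⌈r * n k⌉₊ := Nat.cast_pos.mpr (hmpos k)
    have hnR : (0 : ℝ) < n k := Nat.cast_pos.mpr (hnpos k)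
    have hmr : (r : ℝ) * n k ≤ ⌈r * n k⌉₊ := by exact_mod_cast Nat.le_ceil (r * (n k : ℝ≥0))
    have hmono := R.monotone _ _ ⟨_, hφn k⟩ _ (hN (n k))
    rw [hadd φ _ (hnpos k)] at hmono
    rw [hadd ψ _ (hmpos k)]
    generalize R.val (𝒬.pow A ⌈r * n k⌉₊) _ = z at hmono ⊢
    have hφ0 := hadd.val_nonneg φ
    have habs := neg_abs_le (z - ⌈r * n k⌉₊ * R.val A ψ)
    set m : ℝ := ((⌈r * n k⌉₊ : ℕ) : ℝ)
    set δ : ℝ := |z - m * R.val A ψ|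
    have h1 : m * R.val A ψ - δ ≤ n k * R.val A φ := by linarith
    -- Since `r n ≤ m` and `R(φ) ≥ 0`, the factor `n` can be traded for `m`; dividing by `m` leaves
    -- the error `r δ / m → 0`.
    have h2 : r * (m * R.val A ψ - δ) ≤ m * R.val A φ :=
      calc r * (m * R.val A ψ - δ) ≤ r * (n k * R.val A φ) := by gcongr
        _ = r * n k * R.val A φ := by ring
        _ ≤ m * R.val A φ := by gcongr
    rw [← mul_le_mul_iff_right₀ hmR]
    calc m * (r * R.val A ψ - r * (δ / m)) = r * (m * R.val A ψ - δ) := by field_simp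
      _ ≤ _ := h2
  · refine tendsto_of_tendsto_of_tendsto_of_le_of_le tendsto_const_nhds ?_
      (fun _ => zero_le) (fun k => (hlt k).le)
    have := ENNReal.tendsto_inv_nat_nhds_zero.comp (tendsto_add_atTop_nat 1)
    simpa [Function.comp_def] using this

/-- The conversion rate bounds the ratio of the values of the measure. -/
theorem convRate_mul_val_le (hcont : R.AsymptoticallyContinuous A)
    (hadd : R.WeaklyAdditive A) (φ ψ : 𝒯.states A) :
    𝒯.convRate (φ : Op (𝒬.space A)) (ψ : Op (𝒬.space A)) * ENNReal.ofReal (R.val A ψ)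
      ≤ ENNReal.ofReal (R.val A φ) := by
  simp only [convRate, ENNReal.iSup_mul]
  refine iSup₂_le fun r hr => ?_
  rw [← ENNReal.ofReal_coe_nnreal, ← ENNReal.ofReal_mul r.coe_nonneg]
  exact ENNReal.ofReal_le_ofReal (mul_val_le_of_mem_achievableRates hcont hadd φ ψ hr)

/-- A monotone measure that equals `c` on maximally resourceful states is bounded by `c`. -/
theorem val_le_of_maximalStates {c : ℝ}
    (h : ∀ φ : 𝒯.states A, (φ : Op (𝒬.space A)) ∈ 𝒯.maximalStates A → R.val A φ = c)
    (ψ : 𝒯.states A) : R.val A ψ ≤ c := by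
  obtain ⟨φ, hφ, E, hE, hEφ⟩ := exists_maximalStates_converts ψ.2
  rw [← h ⟨φ, hφ.1⟩ hφ]
  convert R.monotone _ _ ⟨φ, hφ.1⟩ E hE using 2
  exact Subtype.ext hEφ.symm

end Measure

end ResourceTheory

end QRT

/-! ### The uniqueness inequality. -/

theorem proposition24 (𝒬 : QRT.QuantumSystems.{u, v}) (𝒯 : QRT.ResourceTheory 𝒬)
    (Rmax : 𝒬.Sys → ℝ≥0) (H : 𝒬.Sys)
    (hcat : ∀ φ ∈ 𝒯.states H, ¬ 𝒯.CatalyticallyReplicable φ)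
    (R : 𝒯.Measure) (hnorm : R.ConventionallyNormalized H Rmax)
    (hcont : R.AsymptoticallyContinuous H) (hadd : R.WeaklyAdditive H)
    (ψ : 𝒯.states H) :
    ((𝒯.distillable Rmax (ψ : QRT.Op (𝒬.space H)) : ℝ≥0∞) : EReal) ≤ (R.val H ψ : EReal) ∧
      (R.val H ψ : EReal) ≤ ((𝒯.cost Rmax (ψ : QRT.Op (𝒬.space H)) : ℝ≥0∞) : EReal) := by
  have hcoe : (R.val H ψ : EReal) = (ENNReal.ofReal (R.val H ψ) : ℝ≥0∞) :=
    (EReal.coe_ennreal_ofReal.trans (by rw [max_eq_left (hadd.val_nonneg ψ)])).symm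
  rw [hcoe, EReal.coe_ennreal_le_coe_ennreal_iff, EReal.coe_ennreal_le_coe_ennreal_iff]
  constructor
  · obtain ⟨φ, hφ, -⟩ := QRT.ResourceTheory.exists_maximalStates_converts ψ.2
    refine (iInf₂_le φ hφ.1).trans ?_
    have h := QRT.ResourceTheory.Measure.convRate_mul_val_le hcont hadd ψ ⟨φ, hφ.1⟩
    rwa [hnorm.2 ⟨φ, hφ.1⟩ hφ, ENNReal.ofReal_coe_nnreal] at h
  · refine le_iInf₂ fun φ hφ => ?_
    have hmax : ∀ χ : 𝒯.states H, ENNReal.ofReal (R.val H χ) ≤ Rmax H := fun χ =>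
      (ENNReal.ofReal_le_ofReal (QRT.ResourceTheory.Measure.val_le_of_maximalStates
        hnorm.2 χ)).trans_eq ENNReal.ofReal_coe_nnreal
    have h := (QRT.ResourceTheory.Measure.convRate_mul_val_le hcont hadd ⟨φ, hφ⟩ ψ).trans
      (hmax _)
    -- The quotient may be `0 / 0 = 0` when `Rmax H = 0`, but then `R(ψ)` is itself `0`.
    by_cases h0 : Rmax H = 0
    · have := hmax ψ
      rw [h0, ENNReal.coe_zero] at this
      exact this.trans (zero_le)
    · rw [ENNReal.le_div_iff_mul_le (Or.inr (by simpa using h0)) (Or.inr ENNReal.coe_ne_top),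
        mul_comm]
      exact h
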